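/- Work over $\mathbb{C}$. Identify $\mathbb{P}^2$ with the projective space of linear forms in $x_0,x_1,x_2$, and for a finite set $A=\{[L_1],\dots,[L_s]\}\subset\mathbb{P}^2$ and an integer $j\ge 0$ let $\langle v_j(A)\rangle$ be the linear span of $L_1^j,\dots,L_s^j$. A finite set $A\subset\mathbb{P}^2$ computes a form $T$ of degree $d$ if $T\in\langle v_d(A)\rangle$; it is a non-redundant set computing $T$ if moreover no proper subset of $A$ computes $T$. The rank of $T$ is the minimal cardinality of a finite set computing $T$, and $T$ is identifiable if exactly one non-redundant set computing $T$ has cardinality equal to the rank. The $j$-th Kruskal rank $k_j(A)$ is the largest integer $k\le |A|$ such that for every $A'\subseteq A$ with $|A'|\le k$ the vector space $\langle v_j(A')\rangle$ has dimension $|A'|$. The Hilbert function $h_A(j)$ is the rank of the map that evaluates forms of degree $j$ in three variables at (fixed homogeneous coordinates of) the points of $A$, where the point $[a_0x_0+a_1x_1+a_2x_2]$ has coordinates $(a_0,a_1,a_2)$. **Theorem.** Let $T\in\mathbb{C}[x_0,x_1,x_2]$ be a form of degree $d$ and let $A\subset\mathbb{P}^2$ be a non-redundant finite set of $r$ points computing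 $T$. Then $T$ has rank $r$ and is identifiable if one of the following holds: - $d=2m$ is even, $k_{m-1}(A)=\min\left\{\binom{m+1}{2},r\right\}$ and $h_A(m)=r\le\binom{m+2}{2}-2$; - $d=2m+1$ is odd, $k_m(A)=\min\left\{\binom{m+2}{2},r\right\}$ and $h_A(m+1)=r\le\binom{m+2}{2}+\left\lfloor\frac{m}{2}\right\rfloor$. -/

import Mathlib

open scoped LinearAlgebra.Projectivization

namespace Waring

/-- The projective space `ℙⁿ` of linear forms in `x₀, …, xₙ` over `ℂ` (up to scalars); a linear form
`a₀ x₀ + ⋯ + aₙ xₙ` is given by its vector of coefficients `(a₀, …, aₙ)`. -/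
abbrev ProjSpace (n : ℕ) : Type := ℙ ℂ (Fin (n + 1) → ℂ)

/-- The linear form `a₀ x₀ + ⋯ + aₙ xₙ` with coefficient vector `a`. -/
noncomputable def linearForm {n : ℕ} (a : Fin (n + 1) → ℂ) : MvPolynomial (Fin (n + 1)) ℂ :=
  ∑ i, MvPolynomial.C (a i) * MvPolynomial.X i

/-- A form representing the image `v_d(P)` of the point `P` under the Veronese map: the `d`-th power
of a linear form representing `P`. Another representative of `P` changes it by a nonzero scalar. -/
noncomputable def veroneseForm {n : ℕ} (d : ℕ) (P : ProjSpace n) : MvPolynomial (Fin (n + 1)) ℂ :=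
  linearForm P.rep ^ d

/-- The linear span `⟨v_d(A)⟩`, as a vector subspace (its projective dimension is
one less than its dimension as a vector space). -/
noncomputable def veroneseSpan {n : ℕ} (d : ℕ) (A : Finset (ProjSpace n)) :
    Submodule ℂ (MvPolynomial (Fin (n + 1)) ℂ) :=
  Submodule.span ℂ (veroneseForm d '' (A : Set (ProjSpace n)))

/-- The finite set `A` computes the form `T` of degree `d`. -/
def Computes {n : ℕ} (d : ℕ) (A : Finset (ProjSpace n)) (T : MvPolynomial (Fin (n + 1)) ℂ) : Prop :=
  T ∈ veroneseSpan d A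

/-- The finite set `A` computes `T`, and no proper subset of `A` does. -/
def IsNonRedundant {n : ℕ} (d : ℕ) (A : Finset (ProjSpace n))
    (T : MvPolynomial (Fin (n + 1)) ℂ) : Prop :=
  Computes d A T ∧ ∀ A' : Finset (ProjSpace n), A' ⊂ A → ¬ Computes d A' T

/-- The (Waring) rank of a form `T` of degree `d`: the least cardinality of a finite set of points
computing `T`. -/
noncomputable def rank {n : ℕ} (d : ℕ) (T : MvPolynomial (Fin (n + 1)) ℂ) : ℕ :=
  sInf {s : ℕ | ∃ A : Finset (ProjSpace n), Computes d A T ∧ A.card = s}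

/-- The finite set `A` computes the rank of `T`. -/
def ComputesRank {n : ℕ} (d : ℕ) (A : Finset (ProjSpace n))
    (T : MvPolynomial (Fin (n + 1)) ℂ) : Prop :=
  IsNonRedundant d A T ∧ A.card = rank d T

/-- `T` is identifiable: exactly one finite set computes its rank. -/
def IsIdentifiable {n : ℕ} (d : ℕ) (T : MvPolynomial (Fin (n + 1)) ℂ) : Prop :=
  ∃! A : Finset (ProjSpace n), ComputesRank d A T

/-- The `d`-th Kruskal rank of `A`: the largest `k ≤ ℓ(A)` such that, for every subset `A'` of `A`
with at most `k` points, the points of `v_d(A')` are linearly independent, i.e. they span a linear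
space of (projective) dimension `ℓ(A') - 1`. -/
noncomputable def kruskalRank {n : ℕ} (d : ℕ) (A : Finset (ProjSpace n)) : ℕ :=
  sSup {k : ℕ | k ≤ A.card ∧ ∀ A' : Finset (ProjSpace n), A' ⊆ A → A'.card ≤ k →
    Module.finrank ℂ (veroneseSpan d A') = A'.card}

/-- The evaluation map of degree `j` on (homogeneous coordinates of the points of) `A`. -/
noncomputable def evalMap {n : ℕ} (j : ℕ) (A : Finset (ProjSpace n)) :
    MvPolynomial.homogeneousSubmodule (Fin (n + 1)) ℂ j →ₗ[ℂ] (A → ℂ) :=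
  LinearMap.pi fun P =>
    (MvPolynomial.aeval (P : ProjSpace n).rep).toLinearMap ∘ₗ
      (MvPolynomial.homogeneousSubmodule (Fin (n + 1)) ℂ j).subtype

/-- The Hilbert function `h_A(j)`, `j ≥ 0`, of the finite set `A`: the rank of the evaluation map
of degree `j`. -/
noncomputable def hilbertFunction {n : ℕ} (A : Finset (ProjSpace n)) (j : ℕ) : ℕ :=
  Module.finrank ℂ (LinearMap.range (evalMap j A))

end Waring

/-! Let `B` be another set computing `T` with at most `r` points. Subtracting the two expressions of
`T` leaves a relation with nonzero coefficients among the `d`-th powers over a nonempty `A' ⊆ A` and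
a disjoint `B'` with `|B'| ≤ |A'|` (`exists_relation_of_computes`). By apolarity it is a relation
among evaluations of forms of degree `d`, so it can be multiplied by forms. Let `j` be the degree of
the Kruskal condition. That condition passes to `A'`: either `A'` imposes independent conditions in
degree `j`, or no nonzero form of degree `j` vanishes on `A'`.

In the first case, a form of degree `j + 1` through `A'` must contain `B'`, yet independence
separates any further point from `A'` (`eq_empty_of_relation`).

In the second case, `A' ∪ B'` lies on a pencil of curves of degree `j + 1`: for even `d` because
every such curve through `A'` contains `B'`, for odd `d` by a catalecticant count. Remove the common
factor `H` of two members. The points off `H` lie on a complete intersection of type `(f, f)`, hence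
impose independent conditions in degrees at least `2f - 1`. Multiplying the relation by `H` then
shows that no point lies off `H`, and `deg H ≤ j` contradicts the case assumption
(`vanishingForms_ne_bot_of_relation`). -/

namespace Waring

open MvPolynomial

/-! ### Homogeneous forms: factors, dimensions, the Koszul count -/

section Forms

variable {σ K : Type*} [Field K]

/-- The substitution `xᵢ ↦ xᵢ t`, which records degrees by powers of `t`. -/
noncomputable def scaleHom : MvPolynomial σ K →ₐ[K] Polynomial (MvPolynomial σ K) :=
  aeval fun i => Polynomial.C (X i) * Polynomial.X

lemma scaleHom_monomial (s : σ →₀ ℕ) (a : K) :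
    scaleHom (monomial s a) = Polynomial.monomial s.degree (monomial s a) := by
  have h : (s.prod fun i k => (Polynomial.C (X i : MvPolynomial σ K) * Polynomial.X) ^ k) =
      Polynomial.C (s.prod fun i k => X i ^ k) * Polynomial.X ^ s.degree := by
    rw [Finsupp.degree_apply, ← Finset.prod_pow_eq_pow_sum, Finsupp.prod, Finsupp.prod,
      map_prod, ← Finset.prod_mul_distrib]
    exact Finset.prod_congr rfl fun i _ => by rw [mul_pow, map_pow]
  rw [scaleHom, aeval_monomial, h, ← Polynomial.C_mul_X_pow_eq_monomial, monomial_eq,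
    Polynomial.C_mul, ← mul_assoc]
  rfl

lemma coeff_scaleHom (p : MvPolynomial σ K) (n : ℕ) :
    (scaleHom p).coeff n = homogeneousComponent n p := by
  induction p using MvPolynomial.induction_on' with
  | monomial s a =>
    rw [scaleHom_monomial, Polynomial.coeff_monomial]
    split_ifs with h
    · rw [homogeneousComponent_eq_self (isHomogeneous_monomial a h)]
    · rw [homogeneousComponent_of_mem (m := n) (isHomogeneous_monomial a rfl), if_neg]
      exact fun h' => h h'.symm
  | add p q hp hq => simp [hp, hq]

lemma isHomogeneous_iff_scaleHom (p : MvPolynomial σ K) (n : ℕ) :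
    p.IsHomogeneous n ↔ scaleHom p = Polynomial.monomial n p := by
  constructor
  · intro h
    ext1 k
    rw [coeff_scaleHom, Polynomial.coeff_monomial, homogeneousComponent_of_mem h]
    simp only [eq_comm]
  · intro h
    have := congrArg (fun q => Polynomial.coeff q n) h
    simp only [coeff_scaleHom, Polynomial.coeff_monomial_same] at this
    rw [← this]
    exact homogeneousComponent_isHomogeneous n p

lemma isHomogeneous_of_scaleHom_eq_monomial {p q : MvPolynomial σ K} {n : ℕ}
    (h : scaleHom p = Polynomial.monomial n q) : p.IsHomogeneous n := by
  have h1 : ∀ k, homogeneousComponent k p = if n = k then q else 0 := fun k => by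
    rw [← coeff_scaleHom, h, Polynomial.coeff_monomial]
  have : p = q := by
    rw [← sum_homogeneousComponent p]
    by_cases hq : n ∈ Finset.range (p.totalDegree + 1)
    · rw [Finset.sum_congr rfl fun k _ => h1 k, Finset.sum_ite_eq, if_pos hq]
    · have := h1 n
      rw [if_pos rfl, homogeneousComponent_eq_zero] at this
      · rw [Finset.sum_congr rfl fun k _ => h1 k, ← this]; simp
      · simpa using hq
  rw [isHomogeneous_iff_scaleHom, h, this]

/-- Factors of a nonzero form are forms. -/
lemma exists_isHomogeneous_of_mul {p q : MvPolynomial σ K} {n : ℕ}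
    (h : (p * q).IsHomogeneous n) (h0 : p * q ≠ 0) :
    ∃ a b, p.IsHomogeneous a ∧ q.IsHomogeneous b ∧ a + b = n := by
  have inj : Function.Injective (scaleHom : MvPolynomial σ K →ₐ[K] _) := by
    rw [injective_iff_map_eq_zero]
    intro r hr
    rw [← sum_homogeneousComponent r]
    exact Finset.sum_eq_zero fun k _ => by rw [← coeff_scaleHom, hr, Polynomial.coeff_zero]
  have hp : scaleHom p ≠ 0 := fun h' => h0 (by rw [inj (h'.trans (map_zero _).symm), zero_mul])
  have hq : scaleHom q ≠ 0 := fun h' => h0 (by rw [inj (h'.trans (map_zero _).symm), mul_zero])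
  have e : scaleHom p * scaleHom q = Polynomial.monomial n (p * q) := by
    rw [← map_mul, (isHomogeneous_iff_scaleHom _ _).1 h]
  -- Highest and lowest degrees in `t` are both additive. They agree for the product, hence for each
  -- factor.
  have h1 := Polynomial.natDegree_mul hp hq
  have h2 := Polynomial.natTrailingDegree_mul hp hq
  rw [e, Polynomial.natDegree_monomial_eq _ h0] at h1
  rw [e, Polynomial.natTrailingDegree_monomial h0] at h2
  have h3 := Polynomial.natTrailingDegree_le_natDegree (scaleHom p)
  have h4 := Polynomial.natTrailingDegree_le_natDegree (scaleHom q)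
  have key : ∀ r : MvPolynomial σ K,
      (scaleHom r).natTrailingDegree = (scaleHom r).natDegree →
      r.IsHomogeneous (scaleHom r).natDegree := by
    intro r hr
    apply isHomogeneous_of_scaleHom_eq_monomial (q := (scaleHom r).leadingCoeff)
    ext1 k
    rw [Polynomial.coeff_monomial]
    split_ifs with hk
    · rw [← hk]; rfl
    · rcases lt_or_gt_of_ne hk with hk | hk
      · exact Polynomial.coeff_eq_zero_of_natDegree_lt hk
      · exact Polynomial.coeff_eq_zero_of_lt_natTrailingDegree (hr ▸ hk)
  exact ⟨_, _, key p (by omega), key q (by omega), h1.symm⟩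

instance [Finite σ] (n : ℕ) : FiniteDimensional K (homogeneousSubmodule σ K n) :=
  Module.Finite.iff_fg.2 (homogeneousSubmodule_fg σ K n)

lemma finrank_homogeneousSubmodule [Fintype σ] [DecidableEq σ] (n : ℕ) :
    Module.finrank K (homogeneousSubmodule σ K n) =
      (Fintype.card σ + n - 1).choose n := by
  have e : {d : σ →₀ ℕ | d.degree = n} = ((Finset.univ : Finset σ).finsuppAntidiag n : Set _) := by
    ext d
    simp [Finset.mem_finsuppAntidiag, Finsupp.degree_eq_sum]
  rw [homogeneousSubmodule_eq_finsupp_supported]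
  have := (AddMonoidAlgebra.supportedEquivFinsupp (R := K) (S := K) {d : σ →₀ ℕ | d.degree = n}).finrank_eq
  refine Eq.trans this ?_
  have : Fintype {d : σ →₀ ℕ | d.degree = n} := by rw [e]; infer_instance
  rw [Module.finrank_finsupp_self, ← Set.toFinset_card, ← Finset.card_univ (α := σ),
    ← Finset.card_finsuppAntidiag_nat_eq_choose]
  congr 1
  ext d
  simp [Finset.mem_finsuppAntidiag, Finsupp.degree_eq_sum]

lemma finrank_ternary (n : ℕ) :
    Module.finrank K (homogeneousSubmodule (Fin 3) K n) = (n + 2).choose 2 := by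
  rw [finrank_homogeneousSubmodule, Fintype.card_fin, show 3 + n - 1 = n + 2 by omega,
    ← Nat.choose_symm_add]

lemma finrank_binary (n : ℕ) :
    Module.finrank K (homogeneousSubmodule (Fin 2) K n) = n + 1 := by
  rw [finrank_homogeneousSubmodule, Fintype.card_fin, show 2 + n - 1 = n + 1 by omega,
    Nat.choose_symm_add, Nat.choose_one_right]

/-- The degree `f + a` part of the product of a degree `f` form `F` with all forms of degree `a`. -/
noncomputable def multiples (F : MvPolynomial σ K) (a : ℕ) : Submodule K (MvPolynomial σ K) :=
  (homogeneousSubmodule σ K a).map (LinearMap.mulLeft K F)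

lemma mem_multiples {F p : MvPolynomial σ K} {a : ℕ} :
    p ∈ multiples F a ↔ ∃ u : MvPolynomial σ K, u.IsHomogeneous a ∧ F * u = p := by
  simp [multiples, Submodule.mem_map]

instance [Finite σ] (F : MvPolynomial σ K) (a : ℕ) : FiniteDimensional K (multiples F a) := by
  unfold multiples; infer_instance

lemma finrank_multiples {F : MvPolynomial σ K} (hF : F ≠ 0) (a : ℕ) :
    Module.finrank K (multiples F a) = Module.finrank K (homogeneousSubmodule σ K a) :=
  (Submodule.equivMapOfInjective _ (fun _ _ h => mul_left_cancel₀ hF h) _).finrank_eq.symm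

lemma multiples_le {F : MvPolynomial σ K} {f a k : ℕ} (hF : F.IsHomogeneous f) (h : f + a = k) :
    multiples F a ≤ homogeneousSubmodule σ K k := by
  intro p hp
  obtain ⟨u, hu, rfl⟩ := mem_multiples.1 hp
  exact h ▸ hF.mul hu

/-- The dimension count given by the Koszul complex of two coprime forms. -/
lemma finrank_le_finrank_multiples_sup [Finite σ] {F G : MvPolynomial σ K} {f g : ℕ}
    (hG : G.IsHomogeneous g) (hF0 : F ≠ 0) (hG0 : G ≠ 0) (h : IsRelPrime F G) (t : ℕ) :
    Module.finrank K (homogeneousSubmodule σ K (g + t)) +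
        Module.finrank K (homogeneousSubmodule σ K (f + t)) ≤
      Module.finrank K ↥(multiples F (g + t) ⊔ multiples G (f + t)) +
        Module.finrank K (homogeneousSubmodule σ K t) := by
  rw [← finrank_multiples hF0, ← finrank_multiples hG0,
    ← finrank_multiples (mul_ne_zero hF0 hG0) t,
    ← Submodule.finrank_sup_add_finrank_inf_eq]
  -- What remains is that a common multiple of `F` and `G` in this degree is `F * G` times a form of
  -- degree `t`.
  apply Nat.add_le_add_left
  apply Submodule.finrank_mono
  rintro p ⟨h1, h2⟩
  obtain ⟨u, hu, rfl⟩ := mem_multiples.1 h1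
  obtain ⟨v, hv, e⟩ := mem_multiples.1 h2
  obtain ⟨w, rfl⟩ : G ∣ u := h.symm.dvd_of_dvd_mul_left ⟨v, e.symm⟩
  refine mem_multiples.2 ?_
  by_cases h0 : G * w = 0
  · exact ⟨0, isHomogeneous_zero _ _ _, by simp [h0]⟩
  · obtain ⟨a, b, ha, hb, hab⟩ := exists_isHomogeneous_of_mul hu h0
    have : a = g := ha.inj_right hG hG0
    exact ⟨w, by rwa [show t = b by omega], by ring⟩

end Forms

/-! ### Independent conditions and Hilbert functions of finite point sets -/

section Points

variable {n : ℕ}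

lemma eval_smul_of_isHomogeneous {σ K : Type*} [Field K] {F : MvPolynomial σ K} {k : ℕ}
    (hF : F.IsHomogeneous k) (c : K) (v : σ → K) : eval (c • v) F = c ^ k * eval v F := by
  rw [eval_eq, eval_eq, Finset.mul_sum]
  refine Finset.sum_congr rfl fun s hs => ?_
  have : s.degree = k := hF.degree_eq_sum_deg_support hs ▸ rfl
  simp only [Pi.smul_apply, smul_eq_mul, mul_pow, Finset.prod_mul_distrib]
  rw [Finset.prod_pow_eq_pow_sum, ← Finsupp.degree_apply, this]
  ring

/-- The points of `Z` impose independent conditions on forms of degree `j`: there is no nontrivial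
linear relation among the evaluations at these points. -/
def IndependentConditions (j : ℕ) (Z : Finset (ProjSpace n)) : Prop :=
  ∀ c : ProjSpace n → ℂ,
    (∀ F : MvPolynomial (Fin (n + 1)) ℂ, F.IsHomogeneous j → ∑ P ∈ Z, c P * eval P.rep F = 0) →
    ∀ P ∈ Z, c P = 0

lemma exists_rep_ne_zero (P : ProjSpace n) : ∃ i, P.rep i ≠ 0 :=
  Function.ne_iff.1 P.rep_nonzero

lemma exists_linear_separating {P Q : ProjSpace n} (h : P ≠ Q) :
    ∃ l : MvPolynomial (Fin (n + 1)) ℂ, l.IsHomogeneous 1 ∧ eval Q.rep l = 0 ∧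
      eval P.rep l ≠ 0 := by
  have hP : P.rep ∉ Submodule.span ℂ {Q.rep} := by
    intro hmem
    obtain ⟨a, ha⟩ := Submodule.mem_span_singleton.1 hmem
    apply h
    rw [← P.mk_rep, ← Q.mk_rep, Projectivization.mk_eq_mk_iff']
    exact ⟨a, ha⟩
  obtain ⟨f, hf, hf'⟩ := Submodule.exists_dual_map_eq_bot_of_notMem hP inferInstance
  have e : ∀ v, eval v (∑ i, C (f (Pi.single i 1)) * X i : MvPolynomial (Fin (n + 1)) ℂ) = f v := by
    intro v
    conv_rhs => rw [pi_eq_sum_univ' v]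
    simp [mul_comm]
  refine ⟨∑ i, C (f (Pi.single i 1)) * X i,
    IsHomogeneous.sum _ _ _ fun i _ => isHomogeneous_C_mul_X _ _, ?_, ?_⟩
  · rw [e]
    have : f Q.rep ∈ (Submodule.span ℂ {Q.rep}).map f :=
      Submodule.mem_map_of_mem (Submodule.mem_span_singleton_self _)
    rwa [hf', Submodule.mem_bot] at this
  · rwa [e]

lemma IndependentConditions.mono {j : ℕ} {Z Z' : Finset (ProjSpace n)}
    (h : IndependentConditions j Z) (hs : Z' ⊆ Z) : IndependentConditions j Z' := by
  classical
  intro c hc P hP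
  have := h (fun Q => if Q ∈ Z' then c Q else 0) (fun F hF => by
    refine Eq.trans ?_ (hc F hF)
    rw [← Finset.sum_subset hs]
    · exact Finset.sum_congr rfl fun Q hQ => by rw [if_pos hQ]
    · intro Q _ hQ
      rw [if_neg hQ, zero_mul]) P (hs hP)
  simpa [hP] using this

/-- Multiplying by a linear form that vanishes at `Q` but not at `P` turns a relation on `insert Q
Z` into one on `Z` in degree `j`, which kills the coefficient at `P`. A power of a coordinate then
kills the one at `Q`. -/
lemma IndependentConditions.insert [DecidableEq (ProjSpace n)] {j : ℕ} {Z : Finset (ProjSpace n)}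
    (h : IndependentConditions j Z) {Q : ProjSpace n} (hQ : Q ∉ Z) :
    IndependentConditions (j + 1) (insert Q Z) := by
  intro c hc
  simp only [Finset.sum_insert hQ] at hc
  have hZ : ∀ P ∈ Z, c P = 0 := by
    intro P hP
    obtain ⟨l, hl, hlQ, hlP⟩ := exists_linear_separating (P := P) (Q := Q)
      (fun e => hQ (e ▸ hP))
    have := h (fun R => c R * eval R.rep l) (fun F hF => by
      have := hc (F * l) (hF.mul hl)
      simp only [map_mul, hlQ, mul_zero, zero_add] at this
      rw [← this]
      exact Finset.sum_congr rfl fun R _ => by ring) P hP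
    exact (mul_eq_zero.1 this).resolve_right hlP
  intro P hP
  rcases Finset.mem_insert.1 hP with rfl | hP
  · obtain ⟨i, hi⟩ := exists_rep_ne_zero P
    have := hc (X i ^ (j + 1)) (isHomogeneous_X_pow i _)
    rw [Finset.sum_eq_zero fun R hR => by rw [hZ R hR, zero_mul]] at this
    simpa [hi] using this
  · exact hZ P hP

lemma IndependentConditions.succ {j : ℕ} {Z : Finset (ProjSpace n)}
    (h : IndependentConditions j Z) : IndependentConditions (j + 1) Z := by
  intro c hc P hP
  obtain ⟨i, hi⟩ := exists_rep_ne_zero P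
  have := h (fun R => c R * eval R.rep (X i : MvPolynomial (Fin (n + 1)) ℂ)) (fun F hF => by
    rw [← hc (F * X i) (hF.mul (isHomogeneous_X _ i))]
    exact Finset.sum_congr rfl fun R _ => by rw [map_mul]; ring) P hP
  simpa [hi] using this

/-- Each added point costs one degree. The bound is one short of optimal, which makes the base case
the empty set. -/
lemma independentConditions_of_card_le {j : ℕ} {Z : Finset (ProjSpace n)} (h : Z.card ≤ j) :
    IndependentConditions j Z := by
  classical
  induction j generalizing Z with
  | zero =>
    intro c _ P hP
    simp [Finset.card_eq_zero.1 (Nat.le_zero.1 h)] at hP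
  | succ j ih =>
    rcases Z.eq_empty_or_nonempty with rfl | ⟨Q, hQ⟩
    · intro c _ P hP
      simp at hP
    · rw [← Finset.insert_erase hQ]
      refine (ih ?_).insert (Finset.notMem_erase _ _)
      rw [Finset.card_erase_of_mem hQ]
      omega

lemma evalMap_apply (j : ℕ) (Z : Finset (ProjSpace n))
    (F : homogeneousSubmodule (Fin (n + 1)) ℂ j) (P : Z) :
    evalMap j Z F P = eval (P : ProjSpace n).rep (F : MvPolynomial (Fin (n + 1)) ℂ) := by
  simp [evalMap, aeval_eq_eval]

/-- Relations are the linear functionals on `Z → ℂ` that annihilate the image of evaluation. -/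
lemma independentConditions_iff_range_eq_top {j : ℕ} {Z : Finset (ProjSpace n)} :
    IndependentConditions j Z ↔ LinearMap.range (evalMap j Z) = ⊤ := by
  classical
  constructor
  · intro h
    by_contra hne
    obtain ⟨f, hf, hle⟩ := Submodule.exists_le_ker_of_lt_top _ (lt_top_iff_ne_top.2 hne)
    apply hf
    have key : ∀ v : Z → ℂ, f v = ∑ P : Z, f (Pi.single P 1) * v P := by
      intro v
      conv_lhs => rw [pi_eq_sum_univ' v]
      simp [mul_comm]
    have hz := h (fun P => if hP : P ∈ Z then f (Pi.single ⟨P, hP⟩ 1) else 0) (fun F hF => by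
      have := hle (LinearMap.mem_range_self (evalMap j Z) ⟨F, hF⟩)
      rw [LinearMap.mem_ker, key] at this
      rw [← this, ← Finset.sum_coe_sort]
      exact Finset.sum_congr rfl fun P _ => by
        rw [evalMap_apply, dif_pos P.2])
    ext P
    have := hz P P.2
    rw [dif_pos P.2] at this
    simpa using this
  · intro h c hc P hP
    obtain ⟨F, hF⟩ := LinearMap.range_eq_top.1 h (Pi.single ⟨P, hP⟩ 1)
    have := hc F F.2
    rw [← Finset.sum_coe_sort Z (fun P => c P * eval P.rep (F : MvPolynomial (Fin (n + 1)) ℂ))]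
      at this
    simp only [← evalMap_apply, hF] at this
    simpa [Pi.single_apply] using this

lemma independentConditions_iff_hilbertFunction {j : ℕ} {Z : Finset (ProjSpace n)} :
    IndependentConditions j Z ↔ hilbertFunction Z j = Z.card := by
  rw [independentConditions_iff_range_eq_top, hilbertFunction]
  constructor
  · intro h
    rw [h, finrank_top, Module.finrank_fintype_fun_eq_card, Fintype.card_coe]
  · intro h
    apply Submodule.eq_top_of_finrank_eq
    rw [h, Module.finrank_fintype_fun_eq_card, Fintype.card_coe]

lemma IndependentConditions.exists_eval_eq {j : ℕ} {Z : Finset (ProjSpace n)}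
    (h : IndependentConditions j Z) (g : ProjSpace n → ℂ) :
    ∃ F : MvPolynomial (Fin (n + 1)) ℂ, F.IsHomogeneous j ∧ ∀ P ∈ Z, eval P.rep F = g P := by
  obtain ⟨F, hF⟩ := LinearMap.range_eq_top.1 (independentConditions_iff_range_eq_top.1 h)
    (fun P => g P)
  exact ⟨F, F.2, fun P hP => by
    rw [← evalMap_apply j Z F ⟨P, hP⟩, hF]⟩

/-- The degree `j` part of the ideal of `Z`. -/
def vanishingForms (j : ℕ) (Z : Finset (ProjSpace n)) :
    Submodule ℂ (MvPolynomial (Fin (n + 1)) ℂ) where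
  carrier := {F | F.IsHomogeneous j ∧ ∀ P ∈ Z, eval P.rep F = 0}
  add_mem' := fun ha hb => ⟨ha.1.add hb.1, fun P hP => by
    rw [map_add, ha.2 P hP, hb.2 P hP, add_zero]⟩
  zero_mem' := ⟨isHomogeneous_zero _ _ _, fun P _ => map_zero _⟩
  smul_mem' := fun c F hF => ⟨(homogeneousSubmodule _ ℂ j).smul_mem c hF.1, fun P hP => by
    rw [smul_eval, hF.2 P hP, mul_zero]⟩

lemma mem_vanishingForms {j : ℕ} {Z : Finset (ProjSpace n)} {F : MvPolynomial (Fin (n + 1)) ℂ} :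
    F ∈ vanishingForms j Z ↔ F.IsHomogeneous j ∧ ∀ P ∈ Z, eval P.rep F = 0 := Iff.rfl

lemma vanishingForms_le (j : ℕ) (Z : Finset (ProjSpace n)) :
    vanishingForms j Z ≤ homogeneousSubmodule (Fin (n + 1)) ℂ j := fun _ h => h.1

instance (j : ℕ) (Z : Finset (ProjSpace n)) : FiniteDimensional ℂ (vanishingForms j Z) :=
  Submodule.finiteDimensional_of_le (vanishingForms_le j Z)

lemma hilbertFunction_add_finrank_vanishingForms (j : ℕ) (Z : Finset (ProjSpace n)) :
    hilbertFunction Z j + Module.finrank ℂ (vanishingForms j Z) =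
      Module.finrank ℂ (homogeneousSubmodule (Fin (n + 1)) ℂ j) := by
  rw [← LinearMap.finrank_range_add_finrank_ker (evalMap j Z), hilbertFunction]
  congr 1
  have : vanishingForms j Z = (LinearMap.ker (evalMap j Z)).map (Submodule.subtype _) := by
    ext F
    rw [mem_vanishingForms, Submodule.mem_map]
    constructor
    · rintro ⟨h1, h2⟩
      refine ⟨⟨F, h1⟩, ?_, rfl⟩
      rw [LinearMap.mem_ker]
      ext P
      rw [evalMap_apply]
      exact h2 P P.2
    · rintro ⟨G, hG, rfl⟩
      refine ⟨G.2, fun P hP => ?_⟩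
      have := congrFun (LinearMap.mem_ker.1 hG) ⟨P, hP⟩
      rwa [evalMap_apply] at this
  rw [this, Submodule.finrank_map_subtype_eq]

lemma hilbertFunction_le_card (j : ℕ) (Z : Finset (ProjSpace n)) :
    hilbertFunction Z j ≤ Z.card := by
  rw [hilbertFunction]
  refine (Submodule.finrank_le _).trans ?_
  rw [Module.finrank_fintype_fun_eq_card, Fintype.card_coe]

lemma IndependentConditions.card_add_finrank {j : ℕ} {Z : Finset (ProjSpace n)}
    (h : IndependentConditions j Z) :
    Z.card + Module.finrank ℂ (vanishingForms j Z) =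
      Module.finrank ℂ (homogeneousSubmodule (Fin (n + 1)) ℂ j) := by
  rw [← hilbertFunction_add_finrank_vanishingForms j Z,
    independentConditions_iff_hilbertFunction.1 h]

end Points

/-! ### Plane complete intersections, by restriction to a general line -/

section CompleteIntersection

/-- With the Koszul count, this bounds the codimension of the ideal `(F, G)` in degree `f + g + t`
by the Bézout number `f * g`. -/
lemma choose_two_identity (f g t : ℕ) :
    (g + t + 2).choose 2 + (f + t + 2).choose 2 + f * g =
      (f + g + t + 2).choose 2 + (t + 2).choose 2 := by
  have h : ∀ k : ℕ, 2 * (k + 2).choose 2 = (k + 2) * (k + 1) := fun k => by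
    rw [Nat.choose_two_right, Nat.mul_div_cancel' (Nat.even_mul_pred_self _).two_dvd]
    rfl
  have h1 := h (g + t)
  have h2 := h (f + t)
  have h3 := h (f + g + t)
  have h4 := h t
  have : 2 * ((g + t + 2).choose 2 + (f + t + 2).choose 2 + f * g) =
      2 * ((f + g + t + 2).choose 2 + (t + 2).choose 2) := by
    rw [mul_add, mul_add, mul_add, h1, h2, h3, h4]
    ring
  omega

/-- A weak form of Bézout's theorem: two coprime ternary forms have finitely many common zeros. -/
lemma finite_setOf_common_zeros {F G : MvPolynomial (Fin 3) ℂ} {f g : ℕ}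
    (hF : F.IsHomogeneous f) (hG : G.IsHomogeneous g) (hF0 : F ≠ 0) (hG0 : G ≠ 0)
    (h : IsRelPrime F G) :
    {P : ProjSpace 2 | eval P.rep F = 0 ∧ eval P.rep G = 0}.Finite := by
  by_contra hinf
  obtain ⟨Z, hZ, hcard⟩ := Set.Infinite.exists_subset_card_eq hinf (f * g + 1)
  -- Any `t` large enough for the `f * g + 1` points to be independent in degree `f + g + t` would
  -- do.
  obtain ⟨t, ht⟩ : ∃ t, t = f * g + 1 := ⟨_, rfl⟩
  have hk := finrank_le_finrank_multiples_sup (f := f) hG hF0 hG0 h t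
  have hle : multiples F (g + t) ⊔ multiples G (f + t) ≤ vanishingForms (f + g + t) Z := by
    rw [sup_le_iff]
    constructor
    · intro p hp
      refine ⟨multiples_le hF (by ring) hp, fun P hP => ?_⟩
      obtain ⟨u, _, rfl⟩ := mem_multiples.1 hp
      rw [map_mul, (hZ hP).1, zero_mul]
    · intro p hp
      refine ⟨multiples_le hG (by ring) hp, fun P hP => ?_⟩
      obtain ⟨u, _, rfl⟩ := mem_multiples.1 hp
      rw [map_mul, (hZ hP).2, zero_mul]
  have h1 := Submodule.finrank_mono hle
  have h2 : Z.card + Module.finrank ℂ (vanishingForms (f + g + t) Z) =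
      (f + g + t + 2).choose 2 :=
    (independentConditions_of_card_le (by omega)).card_add_finrank.trans (finrank_ternary _)
  have h3 := choose_two_identity f g t
  simp only [finrank_ternary] at hk
  linarith

/-- A binary form of positive degree has a nontrivial zero. -/
lemma exists_zero_of_binary {K : Type*} [Field K] [IsAlgClosed K] {D : MvPolynomial (Fin 2) K}
    {e : ℕ} (hD : D.IsHomogeneous e) (he : 0 < e) : ∃ x : Fin 2 → K, x ≠ 0 ∧ eval x D = 0 := by
  by_contra! hne
  set p : Polynomial K := aeval ![Polynomial.X, 1] D with hp
  have hev : ∀ x, p.eval x = eval ![x, 1] D := by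
    intro x
    rw [hp, ← Polynomial.coe_aeval_eq_eval, comp_aeval_apply, aeval_eq_eval]
    congr 2
    ext i
    fin_cases i <;> simp
  have hdeg : p.degree = 0 := by
    by_contra hd
    obtain ⟨x, hx⟩ := IsAlgClosed.exists_root p hd
    refine hne ![x, 1] (fun h => by simpa using congrFun h 1) ?_
    rw [← hev]; exact hx
  rw [Polynomial.eq_C_of_degree_eq_zero hdeg] at hev
  simp only [Polynomial.eval_C] at hev
  set q : Polynomial K := aeval ![1, Polynomial.X] D with hq
  have hev' : ∀ x, q.eval x = eval ![1, x] D := by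
    intro x
    rw [hq, ← Polynomial.coe_aeval_eq_eval, comp_aeval_apply, aeval_eq_eval]
    congr 2
    ext i
    fin_cases i <;> simp
  have : Infinite K := IsAlgClosed.instInfinite
  -- `p` has no root, so it is a constant `c`. For `x ≠ 0` homogeneity gives `D(1, x) = x ^ e D(1/x,
  -- 1) = c x ^ e`, hence `D(1, 0) = 0`.
  have : q = Polynomial.C (p.coeff 0) * Polynomial.X ^ e := by
    apply Polynomial.eq_of_infinite_eval_eq
    apply Set.Infinite.mono (s := {0}ᶜ)
    · intro x hx
      have hx : x ≠ 0 := hx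
      have e1 : (![1, x] : Fin 2 → K) = x • ![x⁻¹, 1] := by
        ext i; fin_cases i <;> simp [hx]
      change q.eval x = _
      rw [hev', e1, eval_smul_of_isHomogeneous hD, ← hev]
      rw [Polynomial.eval_mul, Polynomial.eval_C, Polynomial.eval_pow, Polynomial.eval_X, mul_comm]
    · exact (Set.finite_singleton 0).infinite_compl
  refine hne ![1, 0] (fun h => by simpa using congrFun h 0) ?_
  rw [← hev', this]
  simp [he.ne']

/-- Finitely many points avoid some line `x₂ = α x₀ + β x₁`. -/
lemma exists_line_avoiding (Z : Finset (ProjSpace 2)) :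
    ∃ α β : ℂ, ∀ P ∈ Z, P.rep 2 ≠ α * P.rep 0 + β * P.rep 1 := by
  -- A line through `P` is a zero `(α, β)` of the nonzero polynomial `q P`; some `(α, β)` avoids the
  -- zeros of the product.
  set q : ProjSpace 2 → MvPolynomial (Fin 2) ℂ :=
    fun P => C (P.rep 2) - (C (P.rep 0) * X 0 + C (P.rep 1) * X 1) with hq
  have hev : ∀ P x, eval x (q P) = P.rep 2 - (x 0 * P.rep 0 + x 1 * P.rep 1) := by
    intro P x
    simp [hq, mul_comm]
  have hq0 : ∀ P, q P ≠ 0 := by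
    intro P h
    obtain ⟨i, hi⟩ := exists_rep_ne_zero P
    have h0 := hev P ![0, 0]
    have h1 := hev P ![1, 0]
    have h2 := hev P ![0, 1]
    simp only [h, map_zero, Matrix.cons_val_zero, Matrix.cons_val_one, zero_mul, one_mul,
      add_zero, zero_add, sub_zero] at h0 h1 h2
    rw [← h0] at h1 h2
    fin_cases i
    · exact hi (by simpa using h1.symm)
    · exact hi (by simpa using h2.symm)
    · exact hi h0.symm
  have hprod : ∏ P ∈ Z, q P ≠ 0 := Finset.prod_ne_zero_iff.2 fun P _ => hq0 P
  obtain ⟨x, hx⟩ : ∃ x, eval x (∏ P ∈ Z, q P) ≠ 0 := by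
    by_contra! h
    exact hprod (MvPolynomial.funext fun x => by rw [h x, map_zero])
  refine ⟨x 0, x 1, fun P hP h => hx ?_⟩
  rw [map_prod]
  exact Finset.prod_eq_zero hP (by rw [hev, h, sub_self])

variable {K : Type*} [Field K]

/-- Restriction of ternary forms to the line `x₂ = α x₀ + β x₁`. -/
noncomputable def restrictLine (α β : K) : MvPolynomial (Fin 3) K →ₐ[K] MvPolynomial (Fin 2) K :=
  aeval ![X 0, X 1, C α * X 0 + C β * X 1]

lemma eval_restrictLine (α β : K) (x : Fin 2 → K) (p : MvPolynomial (Fin 3) K) :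
    eval x (restrictLine α β p) = eval ![x 0, x 1, α * x 0 + β * x 1] p := by
  rw [← MvPolynomial.aeval_eq_eval, restrictLine, comp_aeval_apply, aeval_eq_eval]
  congr 2
  ext i
  fin_cases i <;> simp

lemma isHomogeneous_restrictLine (α β : K) {p : MvPolynomial (Fin 3) K} {k : ℕ}
    (hp : p.IsHomogeneous k) : (restrictLine α β p).IsHomogeneous k := by
  have := hp.aeval (g := ![X 0, X 1, C α * X 0 + C β * X 1]) (n := 1)
    (fun i : Fin 3 => show MvPolynomial.IsHomogeneous
      ((![X 0, X 1, C α * X 0 + C β * X 1] : Fin 3 → MvPolynomial (Fin 2) K) i) 1 by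
      fin_cases i
      · exact isHomogeneous_X _ _
      · exact isHomogeneous_X _ _
      · exact (isHomogeneous_C_mul_X _ _).add (isHomogeneous_C_mul_X _ _))
  rwa [one_mul] at this

/-- Extension of binary forms to ternary forms not involving `x₂`. -/
noncomputable def extendLine : MvPolynomial (Fin 2) K →ₐ[K] MvPolynomial (Fin 3) K :=
  rename ![0, 1]

lemma restrictLine_extendLine (α β : K) (p : MvPolynomial (Fin 2) K) :
    restrictLine α β (extendLine p) = p := by
  change ((restrictLine α β).comp extendLine) p = AlgHom.id K _ p
  congr 1
  ext1 i
  fin_cases i <;> simp [restrictLine, extendLine]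

/-- Modulo the equation of the line, restricting and extending back fixes every variable. -/
lemma dvd_sub_extendLine_restrictLine (α β : K) (p : MvPolynomial (Fin 3) K) :
    (X 2 - (C α * X 0 + C β * X 1)) ∣ p - extendLine (restrictLine α β p) := by
  set l : MvPolynomial (Fin 3) K := X 2 - (C α * X 0 + C β * X 1)
  rw [← Ideal.mem_span_singleton, ← Ideal.Quotient.mk_eq_mk_iff_sub_mem]
  change Ideal.Quotient.mkₐ K (Ideal.span {l}) p =
    ((Ideal.Quotient.mkₐ K (Ideal.span {l})).comp (extendLine.comp (restrictLine α β))) p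
  congr 1
  ext1 i
  fin_cases i
  · simp [restrictLine, extendLine]
  · simp [restrictLine, extendLine]
  · simp only [AlgHom.comp_apply, Ideal.Quotient.mkₐ_eq_mk]
    rw [Ideal.Quotient.mk_eq_mk_iff_sub_mem, Ideal.mem_span_singleton]
    simp [restrictLine, extendLine, l, MvPolynomial.algebraMap_eq]

lemma isUnit_of_isHomogeneous_zero {σ : Type*} {p : MvPolynomial σ K} (hp : p.IsHomogeneous 0)
    (h0 : p ≠ 0) : IsUnit p := by
  rw [← totalDegree_zero_iff_isHomogeneous, totalDegree_eq_zero_iff_eq_C] at hp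
  rw [hp]
  refine (IsUnit.mk0 _ fun h => h0 ?_).map C
  rw [hp, h, C_0]

/-- A common factor is a form; in positive degree it would have a zero, giving a common zero on the
line. -/
lemma restrictLine_isRelPrime [IsAlgClosed K] {α β : K} {F G : MvPolynomial (Fin 3) K} {f : ℕ}
    (hF : F.IsHomogeneous f) (hF0 : restrictLine α β F ≠ 0)
    (h : ∀ v : Fin 3 → K, v ≠ 0 → v 2 = α * v 0 + β * v 1 → eval v F = 0 → eval v G ≠ 0) :
    IsRelPrime (restrictLine α β F) (restrictLine α β G) := by
  rintro D ⟨u, hu⟩ ⟨w, hw⟩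
  obtain ⟨a, b, ha, hb, hab⟩ := exists_isHomogeneous_of_mul
    (hu ▸ isHomogeneous_restrictLine α β hF) (hu ▸ hF0)
  rcases Nat.eq_zero_or_pos a with rfl | hpos
  · exact isUnit_of_isHomogeneous_zero ha (fun h0 => hF0 (by rw [hu, h0, zero_mul]))
  · exfalso
    obtain ⟨x, hx, hx0⟩ := exists_zero_of_binary ha hpos
    refine h ![x 0, x 1, α * x 0 + β * x 1] ?_ (by simp) ?_ ?_
    · intro hv
      apply hx
      ext i
      fin_cases i
      · simpa using congrFun hv 0
      · simpa using congrFun hv 1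
    · rw [← eval_restrictLine, hu, map_mul, hx0, zero_mul]
    · rw [← eval_restrictLine, hw, map_mul, hx0, zero_mul]

lemma restrictLine_ne_zero [IsAlgClosed K] {α β : K} {F G : MvPolynomial (Fin 3) K} {g : ℕ}
    (hG : G.IsHomogeneous g) (hg : 0 < g)
    (h : ∀ v : Fin 3 → K, v ≠ 0 → v 2 = α * v 0 + β * v 1 → eval v F = 0 → eval v G ≠ 0) :
    restrictLine α β F ≠ 0 := by
  intro hF
  obtain ⟨x, hx, hx0⟩ := exists_zero_of_binary (isHomogeneous_restrictLine α β hG) hg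
  refine h ![x 0, x 1, α * x 0 + β * x 1] ?_ (by simp) ?_ ?_
  · intro hv
    apply hx
    ext i
    fin_cases i
    · simpa using congrFun hv 0
    · simpa using congrFun hv 1
  · rw [← eval_restrictLine, hF, map_zero]
  · rw [← eval_restrictLine, hx0]

/-- If two forms have no common zero on a line, then together with the equation of the line they
generate all forms of large degree. -/
lemma exists_eq_add_of_no_common_zero [IsAlgClosed K] {α β : K} {F G : MvPolynomial (Fin 3) K}
    {f g : ℕ} (hF : F.IsHomogeneous f) (hG : G.IsHomogeneous g) (hf : 0 < f) (hg : 0 < g)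
    (h : ∀ v : Fin 3 → K, v ≠ 0 → v 2 = α * v 0 + β * v 1 → eval v F = 0 → eval v G ≠ 0)
    {k : ℕ} (hk : f + g ≤ k + 1) {p : MvPolynomial (Fin 3) K} (hp : p.IsHomogeneous (k + 1)) :
    ∃ u v w : MvPolynomial (Fin 3) K, u.IsHomogeneous k ∧
      p = (X 2 - (C α * X 0 + C β * X 1)) * u + (F * v + G * w) := by
  obtain ⟨t, ht⟩ := Nat.exists_eq_add_of_le hk
  rw [ht] at hp
  have hF0 := restrictLine_ne_zero hG hg h
  have hG0 : restrictLine α β G ≠ 0 :=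
    restrictLine_ne_zero hF hf (fun v h0 hv hG hF => h v h0 hv hF hG)
  have hrp := restrictLine_isRelPrime hF hF0 h
  have hle : multiples (restrictLine α β F) (g + t) ⊔ multiples (restrictLine α β G) (f + t) ≤
      homogeneousSubmodule (Fin 2) K (f + g + t) :=
    sup_le (multiples_le (isHomogeneous_restrictLine α β hF) (by ring))
      (multiples_le (isHomogeneous_restrictLine α β hG) (by ring))
  have hk := finrank_le_finrank_multiples_sup (f := f) (isHomogeneous_restrictLine α β hG) hF0 hG0 hrp t
  -- For binary forms the Koszul count gives dimension at least `f + g + t + 1`, which is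
  -- everything.
  have heq := Submodule.eq_of_le_of_finrank_le hle (by
    simp only [finrank_binary] at hk ⊢
    omega)
  have hmem : restrictLine α β p ∈ homogeneousSubmodule (Fin 2) K (f + g + t) :=
    isHomogeneous_restrictLine α β hp
  rw [← heq] at hmem
  obtain ⟨_, h1, _, h2, e⟩ := Submodule.mem_sup.1 hmem
  obtain ⟨a, ha, rfl⟩ := mem_multiples.1 h1
  obtain ⟨b, hb, rfl⟩ := mem_multiples.1 h2
  set q := F * extendLine a + G * extendLine b with hq
  have hqh : q.IsHomogeneous (f + g + t) := by
    refine IsHomogeneous.add ?_ ?_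
    · rw [add_assoc]
      exact hF.mul ha.rename_isHomogeneous
    · rw [add_comm f g, add_assoc]
      exact hG.mul hb.rename_isHomogeneous
  obtain ⟨u, hu⟩ := dvd_sub_extendLine_restrictLine α β (p - q)
  have : restrictLine α β (p - q) = 0 := by
    rw [map_sub, hq, map_add, map_mul, map_mul, restrictLine_extendLine, restrictLine_extendLine,
      e, sub_self]
  rw [this, map_zero, sub_zero] at hu
  by_cases h0 : p - q = 0
  · exact ⟨0, extendLine a, extendLine b, isHomogeneous_zero _ _ _, by
      rw [mul_zero, zero_add]; exact sub_eq_zero.1 h0⟩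
  · obtain ⟨c, d, hc, hd, hcd⟩ := exists_isHomogeneous_of_mul (hu ▸ hp.sub hqh) (hu ▸ h0)
    have hl : (X 2 - (C α * X 0 + C β * X 1) : MvPolynomial (Fin 3) K).IsHomogeneous 1 :=
      (isHomogeneous_X _ _).sub ((isHomogeneous_C_mul_X _ _).add (isHomogeneous_C_mul_X _ _))
    have hc1 : c = 1 := hc.inj_right hl (left_ne_zero_of_mul (hu ▸ h0))
    exact ⟨u, extendLine a, extendLine b, by rwa [show k = d by omega], by
      rw [← hu, ← hq]; ring⟩

/-- Points in the common zero set of two coprime ternary forms of positive degrees `f` and `g`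
impose independent conditions on forms of degree at least `f + g - 1`. -/
theorem independentConditions_of_subset_completeIntersection {F G : MvPolynomial (Fin 3) ℂ}
    {f g : ℕ} (hF : F.IsHomogeneous f) (hG : G.IsHomogeneous g) (hf : 0 < f) (hg : 0 < g)
    (hF0 : F ≠ 0) (hG0 : G ≠ 0) (h : IsRelPrime F G) {Z : Finset (ProjSpace 2)}
    (hZ : ∀ P ∈ Z, eval P.rep F = 0 ∧ eval P.rep G = 0) {k : ℕ} (hk : f + g ≤ k + 1) :
    IndependentConditions k Z := by
  have hfin := finite_setOf_common_zeros hF hG hF0 hG0 h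
  obtain ⟨α, β, hline⟩ := exists_line_avoiding hfin.toFinset
  have hno : ∀ v : Fin 3 → ℂ, v ≠ 0 → v 2 = α * v 0 + β * v 1 → eval v F = 0 → eval v G ≠ 0 := by
    intro v hv0 hv hvF hvG
    obtain ⟨a, ha⟩ := Projectivization.exists_smul_eq_mk_rep ℂ v hv0
    have ha' : (Projectivization.mk ℂ v hv0).rep = (a : ℂ) • v := ha.symm
    refine hline (Projectivization.mk ℂ v hv0) ?_ ?_
    · rw [Set.Finite.mem_toFinset, Set.mem_ofPred_eq, ha', eval_smul_of_isHomogeneous hF,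
        eval_smul_of_isHomogeneous hG, hvF, hvG, mul_zero, mul_zero]
      exact ⟨rfl, rfl⟩
    · rw [ha']
      simp only [Pi.smul_apply, smul_eq_mul, hv]
      ring
  set l : MvPolynomial (Fin 3) ℂ := X 2 - (C α * X 0 + C β * X 1) with hl
  have hlP : ∀ P ∈ Z, eval P.rep l ≠ 0 := by
    intro P hP h0
    refine hline P ((Set.Finite.mem_toFinset _).2 (hZ P hP)) ?_
    simpa [hl, sub_eq_zero] using h0
  -- On `Z` a form of degree `k + 1` equals `l * u`, so dividing coefficients by the values of `l`
  -- raises a relation from degree `k` to `k + 1`. Independence thus descends from degrees at least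
  -- `Z.card`.
  have lift : ∀ k, f + g ≤ k + 1 → IndependentConditions (k + 1) Z →
      IndependentConditions k Z := by
    intro k hk hind c hc P hP
    have := hind (fun P => c P / eval P.rep l) (fun p hp => by
      obtain ⟨u, v, w, hu, e⟩ := exists_eq_add_of_no_common_zero hF hG hf hg hno hk hp
      have hval : ∀ P ∈ Z, eval P.rep p = eval P.rep l * eval P.rep u := by
        intro P hP
        rw [e, map_add, map_add, map_mul, map_mul, map_mul, (hZ P hP).1, (hZ P hP).2]
        ring
      rw [← hc u hu]
      refine Finset.sum_congr rfl fun P hP => ?_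
      rw [hval P hP]
      have := hlP P hP
      field_simp) P hP
    exact (div_eq_zero_iff.1 this).resolve_right (hlP P hP)
  have main : ∀ N k, f + g ≤ k + 1 → Z.card ≤ k + N → IndependentConditions k Z := by
    intro N
    induction N with
    | zero => exact fun k _ h => independentConditions_of_card_le h
    | succ N ih => exact fun k hk h => lift k hk (ih (k + 1) (by omega) (by omega))
  exact main Z.card k hk (by omega)

end CompleteIntersection

/-! ### Relations between two disjoint point sets -/

section Decompositions

variable {n : ℕ}

/-- The two sides of a relation between disjoint sets `A` and `B` in degree `i + j`, where `A`
imposes independent conditions in degrees `i` and `j` and `B` is not larger than `A`: the set `B`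
imposes independent conditions in degree `i`, and forms of degree `j` through `A` contain `B`. -/
lemma vanishingForms_le_of_relation {i j : ℕ} {A B : Finset (ProjSpace n)} {c : ProjSpace n → ℂ}
    (hi : IndependentConditions i A) (hj : IndependentConditions j A) (hcard : B.card ≤ A.card)
    (hcA : ∀ P ∈ A, c P ≠ 0) (hcB : ∀ P ∈ B, c P ≠ 0)
    (hc : ∀ F : MvPolynomial (Fin (n + 1)) ℂ, F.IsHomogeneous (i + j) →
      ∑ P ∈ A, c P * eval P.rep F + ∑ P ∈ B, c P * eval P.rep F = 0) :
    B.card = A.card ∧ vanishingForms j A ≤ vanishingForms j B := by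
  -- Multiplying by a form through `B` leaves a relation on `A` alone, in degree `j`.
  have hle : vanishingForms i B ≤ vanishingForms i A := by
    intro F hF
    refine ⟨hF.1, fun P hP => ?_⟩
    have := hj (fun Q => c Q * eval Q.rep F) (fun G hG => by
      have := hc (F * G) (hF.1.mul hG)
      rw [Finset.sum_eq_zero (s := B) fun Q hQ => by rw [map_mul, hF.2 Q hQ]; ring, add_zero]
        at this
      rw [← this]
      exact Finset.sum_congr rfl fun Q _ => by rw [map_mul]; ring) P hP
    exact (mul_eq_zero.1 this).resolve_left (hcA P hP)
  have h1 := Submodule.finrank_mono hle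
  have h2 := hi.card_add_finrank
  have h3 := hilbertFunction_add_finrank_vanishingForms i B
  have h4 := hilbertFunction_le_card i B
  -- The inclusion gives `h_B(i) ≥ h_A(i) = |A| ≥ |B|`, so all are equal.
  have hB : IndependentConditions i B := independentConditions_iff_hilbertFunction.2 (by omega)
  refine ⟨by omega, fun G hG => ⟨hG.1, fun P hP => ?_⟩⟩
  have := hB (fun Q => c Q * eval Q.rep G) (fun F hF => by
    have := hc (F * G) (hF.mul hG.1)
    rw [Finset.sum_eq_zero (s := A) fun Q hQ => by rw [map_mul, hG.2 Q hQ]; ring, zero_add]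
      at this
    rw [← this]
    exact Finset.sum_congr rfl fun Q _ => by rw [map_mul]; ring) P hP
  exact (mul_eq_zero.1 this).resolve_left (hcB P hP)

/-- There is no relation between `A` and a disjoint set which is not larger, if `A` imposes
independent conditions in degree `i` and is cut out by forms of the complementary degree. -/
lemma eq_empty_of_relation {i j : ℕ} {A B : Finset (ProjSpace n)} {c : ProjSpace n → ℂ}
    (hi : IndependentConditions i A) (hj : IndependentConditions j A) (hcard : B.card ≤ A.card)
    (hdisj : Disjoint A B) (hcA : ∀ P ∈ A, c P ≠ 0) (hcB : ∀ P ∈ B, c P ≠ 0)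
    (hc : ∀ F : MvPolynomial (Fin (n + 1)) ℂ, F.IsHomogeneous (i + (j + 1)) →
      ∑ P ∈ A, c P * eval P.rep F + ∑ P ∈ B, c P * eval P.rep F = 0) :
    A = ∅ := by
  classical
  obtain ⟨h1, h2⟩ := vanishingForms_le_of_relation hi hj.succ hcard hcA hcB hc
  have hB : B = ∅ := by
    by_contra hne
    obtain ⟨Q, hQ⟩ := Finset.nonempty_iff_ne_empty.2 hne
    have hQA : Q ∉ A := Finset.disjoint_right.1 hdisj hQ
    obtain ⟨F, hF, hFv⟩ := (hj.insert hQA).exists_eval_eq (fun P => if P = Q then 1 else 0)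
    have := (h2 (x := F) ⟨hF, fun P hP => by
      rw [hFv P (Finset.mem_insert_of_mem hP), if_neg]
      rintro rfl
      exact hQA hP⟩).2 Q hQ
    rw [hFv Q (Finset.mem_insert_self _ _), if_pos rfl] at this
    exact one_ne_zero this
  rw [hB, Finset.card_empty] at h1
  exact Finset.card_eq_zero.1 h1.symm

/-- Forms of degree `j` in the kernel of the catalecticant pairing with forms of degree `i`
contain the ideals of both sides of a relation, which gives many forms vanishing on both. -/
lemma finrank_vanishingForms_union_of_relation [DecidableEq (ProjSpace n)] {i j : ℕ}
    {A B : Finset (ProjSpace n)} {c : ProjSpace n → ℂ}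
    (hi : vanishingForms i A = ⊥) (hj : IndependentConditions j A)
    (hcA : ∀ P ∈ A, c P ≠ 0)
    (hc : ∀ F : MvPolynomial (Fin (n + 1)) ℂ, F.IsHomogeneous (i + j) →
      ∑ P ∈ A, c P * eval P.rep F + ∑ P ∈ B, c P * eval P.rep F = 0) :
    Module.finrank ℂ (homogeneousSubmodule (Fin (n + 1)) ℂ j) +
        Module.finrank ℂ (homogeneousSubmodule (Fin (n + 1)) ℂ i) ≤
      Module.finrank ℂ (vanishingForms j (A ∪ B)) + A.card + B.card := by
  let S := homogeneousSubmodule (Fin (n + 1)) ℂ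
  let Φ : S j →ₗ[ℂ] S i →ₗ[ℂ] ℂ := LinearMap.mk₂ ℂ
    (fun G F => ∑ P ∈ A, c P * (eval P.rep (F : MvPolynomial (Fin (n + 1)) ℂ) *
      eval P.rep (G : MvPolynomial (Fin (n + 1)) ℂ)))
    (fun G G' F => by
      simp only [Submodule.coe_add, map_add, mul_add, Finset.sum_add_distrib])
    (fun a G F => by
      simp only [Submodule.coe_smul, smul_eval, smul_eq_mul, Finset.mul_sum]
      exact Finset.sum_congr rfl fun P _ => by ring)
    (fun G F F' => by
      simp only [Submodule.coe_add, map_add, add_mul, mul_add, Finset.sum_add_distrib])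
    (fun a G F => by
      simp only [Submodule.coe_smul, smul_eval, smul_eq_mul, Finset.mul_sum]
      exact Finset.sum_congr rfl fun P _ => by ring)
  have hΦ : ∀ G F, Φ G F = ∑ P ∈ A, c P * (eval P.rep (F : MvPolynomial (Fin (n + 1)) ℂ) *
      eval P.rep (G : MvPolynomial (Fin (n + 1)) ℂ)) := fun _ _ => rfl
  -- Evaluation on `A` is injective in degree `i`, so any functional is a weighted sum of
  -- evaluations on `A`. Independence in degree `j` and `c ≠ 0` let `G` realize the weights.
  have hsurj : LinearMap.range Φ = ⊤ := by
    rw [LinearMap.range_eq_top]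
    intro φ
    have hker : LinearMap.ker (evalMap i A) = ⊥ := by
      rw [Submodule.eq_bot_iff]
      intro F hF
      have : (F : MvPolynomial (Fin (n + 1)) ℂ) ∈ vanishingForms i A := ⟨F.2, fun P hP => by
        rw [← evalMap_apply i A F ⟨P, hP⟩, LinearMap.mem_ker.1 hF, Pi.zero_apply]⟩
      rw [hi, Submodule.mem_bot] at this
      exact Subtype.ext this
    obtain ⟨L, hL⟩ := LinearMap.exists_leftInverse_of_injective _ hker
    obtain ⟨G, hG, hGv⟩ := hj.exists_eval_eq (fun P =>
      if hP : P ∈ A then φ (L (Pi.single ⟨P, hP⟩ 1)) / c P else 0)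
    refine ⟨⟨G, hG⟩, ?_⟩
    ext F
    have e1 : F = L (evalMap i A F) := (LinearMap.congr_fun hL F).symm
    conv_rhs => rw [e1, pi_eq_sum_univ' (evalMap i A F)]
    rw [hΦ, ← Finset.sum_coe_sort]
    simp only [map_sum, map_smul, smul_eq_mul]
    refine Finset.sum_congr rfl fun P _ => ?_
    rw [hGv P P.2, dif_pos P.2, evalMap_apply]
    have := hcA P P.2
    field_simp
  have h0 := LinearMap.finrank_range_add_finrank_ker Φ
  rw [hsurj, finrank_top, Module.finrank_linearMap_self] at h0
  have hAK : LinearMap.ker (evalMap j A) ≤ LinearMap.ker Φ := by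
    intro G hG
    rw [LinearMap.mem_ker]
    ext F
    rw [hΦ, LinearMap.zero_apply]
    refine Finset.sum_eq_zero fun P hP => ?_
    rw [← evalMap_apply j A G ⟨P, hP⟩, LinearMap.mem_ker.1 hG, Pi.zero_apply]
    ring
  -- By the relation, `Φ` is also minus the corresponding sum over `B`.
  have hBK : LinearMap.ker (evalMap j B) ≤ LinearMap.ker Φ := by
    intro G hG
    rw [LinearMap.mem_ker]
    ext F
    rw [hΦ, LinearMap.zero_apply]
    have := hc (F * G) (F.2.mul G.2)
    rw [Finset.sum_eq_zero (s := B) fun P hP => by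
      rw [map_mul, ← evalMap_apply j B G ⟨P, hP⟩, LinearMap.mem_ker.1 hG, Pi.zero_apply]
      ring, add_zero] at this
    simpa using this
  have h1 := Submodule.finrank_mono (sup_le hAK hBK)
  have h2 := Submodule.finrank_sup_add_finrank_inf_eq (LinearMap.ker (evalMap j A))
    (LinearMap.ker (evalMap j B))
  have h3 : Module.finrank ℂ ↥(LinearMap.ker (evalMap j A) ⊓ LinearMap.ker (evalMap j B)) ≤
      Module.finrank ℂ (vanishingForms j (A ∪ B)) := by
    rw [← Submodule.finrank_map_subtype_eq]
    apply Submodule.finrank_mono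
    rintro _ ⟨G, ⟨hG1, hG2⟩, rfl⟩
    refine ⟨G.2, fun P hP => ?_⟩
    rcases Finset.mem_union.1 hP with hP | hP
    · rw [Submodule.subtype_apply, ← evalMap_apply j A G ⟨P, hP⟩, LinearMap.mem_ker.1 hG1,
        Pi.zero_apply]
    · rw [Submodule.subtype_apply, ← evalMap_apply j B G ⟨P, hP⟩, LinearMap.mem_ker.1 hG2,
        Pi.zero_apply]
  have h4 := LinearMap.finrank_range_add_finrank_ker (evalMap j A)
  have h5 := LinearMap.finrank_range_add_finrank_ker (evalMap j B)
  have h6 := hilbertFunction_le_card j A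
  have h7 := hilbertFunction_le_card j B
  simp only [hilbertFunction] at h6 h7
  simp only [S] at h0
  omega

/-- A finite set of points of the plane that carries a relation with nonzero coefficients in degree
at least `2 j + 1` and lies on a pencil of curves of degree `j + 1` lies on a curve of degree `j`. -/
lemma vanishingForms_ne_bot_of_relation {d j : ℕ} {Z : Finset (ProjSpace 2)} {c : ProjSpace 2 → ℂ}
    (hd : 2 * j + 1 ≤ d) (hcZ : ∀ P ∈ Z, c P ≠ 0)
    (hc : ∀ F : MvPolynomial (Fin 3) ℂ, F.IsHomogeneous d → ∑ P ∈ Z, c P * eval P.rep F = 0)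
    (h2 : 2 ≤ Module.finrank ℂ (vanishingForms (j + 1) Z)) :
    vanishingForms j Z ≠ ⊥ := by
  classical
  obtain ⟨F, hF, hF0⟩ : ∃ F ∈ vanishingForms (j + 1) Z, F ≠ 0 := by
    by_contra! h
    rw [(Submodule.eq_bot_iff _).2 h, finrank_bot] at h2
    omega
  obtain ⟨G, hG, hGF⟩ : ∃ G ∈ vanishingForms (j + 1) Z, G ∉ Submodule.span ℂ {F} := by
    by_contra! h
    rw [← Finset.coe_singleton] at h
    have := (Submodule.finrank_mono h).trans (finrank_span_finset_le_card {F})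
    rw [Finset.card_singleton] at this
    exact absurd (h2.trans this) (by norm_num)
  have hG0 : G ≠ 0 := by
    rintro rfl
    exact hGF (Submodule.zero_mem _)
  obtain ⟨F', G', H, hrp, rfl, rfl⟩ := UniqueFactorizationMonoid.exists_reduced_factors F hF0 G
  obtain ⟨e, f, hHe, hFf, hef⟩ := exists_isHomogeneous_of_mul hF.1 hF0
  obtain ⟨e', g, hHe', hGg, heg⟩ := exists_isHomogeneous_of_mul hG.1 hG0
  have hH0 := left_ne_zero_of_mul hF0
  have hF'0 := right_ne_zero_of_mul hF0
  have hG'0 := right_ne_zero_of_mul hG0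
  obtain rfl : e = e' := hHe.inj_right hHe' hH0
  obtain rfl : f = g := by omega
  -- If `f = 0`, both reduced factors are constants and `G` is a multiple of `F`.
  have hf : 0 < f := by
    rw [Nat.pos_iff_ne_zero]
    rintro rfl
    rw [← totalDegree_zero_iff_isHomogeneous, totalDegree_eq_zero_iff_eq_C] at hFf hGg
    apply hGF
    rw [hFf] at hF'0
    rw [hFf, hGg, Submodule.mem_span_singleton]
    have h0 : coeff 0 F' ≠ 0 := fun h => hF'0 (by rw [h, C_0])
    refine ⟨coeff 0 G' / coeff 0 F', ?_⟩
    rw [smul_eq_C_mul, mul_left_comm, ← C_mul, div_mul_cancel₀ _ h0]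
  -- From `e + f = j + 1` and `2 * j + 1 ≤ d` follows `2 * f ≤ (d - e) + 1`.
  have hind : IndependentConditions (d - e) (Z.filter fun P => eval P.rep H ≠ 0) := by
    refine independentConditions_of_subset_completeIntersection hFf hGg hf hf hF'0 hG'0 hrp
      (fun P hP => ?_) (by omega)
    rw [Finset.mem_filter] at hP
    have h1 := hF.2 P hP.1
    have h2 := hG.2 P hP.1
    rw [map_mul] at h1 h2
    exact ⟨(mul_eq_zero.1 h1).resolve_left hP.2, (mul_eq_zero.1 h2).resolve_left hP.2⟩
  have hHZ : ∀ P ∈ Z, eval P.rep H = 0 := by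
    intro P hP
    by_contra hPH
    have := hind (fun Q => c Q * eval Q.rep H) (fun p hp => by
      have := hc (H * p) (by
        have := hHe.mul hp
        rwa [show e + (d - e) = d by omega] at this)
      refine Eq.trans ?_ this
      rw [Finset.sum_filter]
      refine Finset.sum_congr rfl fun Q _ => ?_
      rw [map_mul]
      split_ifs with h
      · ring
      · rw [not_not.1 h]; ring) P (Finset.mem_filter.2 ⟨hP, hPH⟩)
    exact (mul_ne_zero (hcZ P hP) hPH) this
  intro hbot
  -- Since `f > 0`, `H` has degree `e ≤ j`; it is padded up to degree `j`.
  have hmem : H * X 0 ^ (j - e) ∈ vanishingForms j Z := by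
    refine ⟨?_, fun P hP => by rw [map_mul, hHZ P hP, zero_mul]⟩
    have := hHe.mul (isHomogeneous_X_pow (R := ℂ) (0 : Fin 3) (j - e))
    rwa [show e + (j - e) = j by omega] at this
  rw [hbot, Submodule.mem_bot] at hmem
  exact mul_ne_zero hH0 (pow_ne_zero _ (X_ne_zero _)) hmem

lemma vanishingForms_union_eq_bot [DecidableEq (ProjSpace n)] {j : ℕ} {A B : Finset (ProjSpace n)}
    (h : vanishingForms j A = ⊥) : vanishingForms j (A ∪ B) = ⊥ :=
  eq_bot_iff.2 fun _ hF => h ▸ ⟨hF.1, fun P hP => hF.2 P (Finset.mem_union_left _ hP)⟩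

/-- Here `m` is one less than in the theorem. The bound on `A.card` leaves two independent forms of
degree `m + 1` through `A`, and these contain `B`. -/
lemma eq_empty_of_relation_even {m : ℕ} {A B : Finset (ProjSpace 2)} {c : ProjSpace 2 → ℂ}
    (hk : IndependentConditions m A ∨ vanishingForms m A = ⊥)
    (hm : IndependentConditions (m + 1) A) (hA : A.card + 2 ≤ (m + 3).choose 2)
    (hcard : B.card ≤ A.card) (hdisj : Disjoint A B)
    (hcA : ∀ P ∈ A, c P ≠ 0) (hcB : ∀ P ∈ B, c P ≠ 0)
    (hc : ∀ F : MvPolynomial (Fin 3) ℂ, F.IsHomogeneous (2 * (m + 1)) →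
      ∑ P ∈ A, c P * eval P.rep F + ∑ P ∈ B, c P * eval P.rep F = 0) :
    A = ∅ := by
  classical
  rw [two_mul] at hc
  rcases hk with hk | hk
  · exact eq_empty_of_relation hm hk hcard hdisj hcA hcB hc
  · exfalso
    obtain ⟨_, hle⟩ := vanishingForms_le_of_relation hm hm hcard hcA hcB hc
    have hle' : vanishingForms (m + 1) A ≤ vanishingForms (m + 1) (A ∪ B) := fun F hF =>
      ⟨hF.1, fun P hP => (Finset.mem_union.1 hP).elim (hF.2 P) ((hle hF).2 P)⟩
    have h1 := Submodule.finrank_mono hle'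
    have h2 : A.card + Module.finrank ℂ (vanishingForms (m + 1) A) = (m + 3).choose 2 :=
      hm.card_add_finrank.trans (finrank_ternary _)
    refine vanishingForms_ne_bot_of_relation (Z := A ∪ B) (c := c) (d := m + 1 + (m + 1)) (j := m)
      (by omega) (fun P hP => (Finset.mem_union.1 hP).elim (hcA P) (hcB P)) (fun F hF => ?_)
      (by omega) (vanishingForms_union_eq_bot hk)
    rw [Finset.sum_union hdisj, hc F hF]

/-- The catalecticant count leaves at least `m + 2 - 2 * (m / 2) ≥ 2` independent forms of degree `m
+ 1` through `A ∪ B`. -/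
lemma eq_empty_of_relation_odd {m : ℕ} {A B : Finset (ProjSpace 2)} {c : ProjSpace 2 → ℂ}
    (hk : IndependentConditions m A ∨ vanishingForms m A = ⊥)
    (hm : IndependentConditions (m + 1) A) (hA : A.card ≤ (m + 2).choose 2 + m / 2)
    (hcard : B.card ≤ A.card) (hdisj : Disjoint A B)
    (hcA : ∀ P ∈ A, c P ≠ 0) (hcB : ∀ P ∈ B, c P ≠ 0)
    (hc : ∀ F : MvPolynomial (Fin 3) ℂ, F.IsHomogeneous (2 * m + 1) →
      ∑ P ∈ A, c P * eval P.rep F + ∑ P ∈ B, c P * eval P.rep F = 0) :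
    A = ∅ := by
  classical
  rw [show 2 * m + 1 = m + (m + 1) by ring] at hc
  rcases hk with hk | hk
  · exact eq_empty_of_relation hk hk hcard hdisj hcA hcB hc
  · exfalso
    have h1 : (m + 3).choose 2 + (m + 2).choose 2 ≤
        Module.finrank ℂ (vanishingForms (m + 1) (A ∪ B)) + A.card + B.card := by
      have := finrank_vanishingForms_union_of_relation hk hm hcA hc
      rwa [finrank_ternary, finrank_ternary] at this
    have h2 : (m + 3).choose 2 = (m + 2) + (m + 2).choose 2 := by
      rw [Nat.choose_succ_succ' (m + 2) 1, Nat.choose_one_right]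
    refine vanishingForms_ne_bot_of_relation (Z := A ∪ B) (c := c) (d := m + (m + 1)) (j := m)
      (by omega) (fun P hP => (Finset.mem_union.1 hP).elim (hcA P) (hcB P)) (fun F hF => ?_)
      (by omega) (vanishingForms_union_eq_bot hk)
    rw [Finset.sum_union hdisj, hc F hF]

end Decompositions

/-! ### Apolarity, Kruskal rank and comparison of decompositions -/

section Apolarity

variable {n : ℕ}

lemma coeff_linearForm_pow (a : Fin (n + 1) → ℂ) (j : ℕ) (s : Fin (n + 1) →₀ ℕ) :
    coeff s (linearForm a ^ j) =
      if s.degree = j then (s.multinomial : ℂ) * eval a (monomial s 1) else 0 := by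
  have : linearForm a = ∑ i, a i • X i := by
    simp only [linearForm, smul_eq_C_mul]
  rw [this, coeff_linearCombination_X_pow_of_fintype, eval_monomial, one_mul]
  rfl

/-- Apolarity: linear relations between `j`-th powers of linear forms are linear relations between
evaluations of forms of degree `j`. -/
lemma sum_smul_veroneseForm_eq_zero_iff {j : ℕ} {Z : Finset (ProjSpace n)} {c : ProjSpace n → ℂ} :
    ∑ P ∈ Z, c P • veroneseForm j P = 0 ↔
      ∀ F : MvPolynomial (Fin (n + 1)) ℂ, F.IsHomogeneous j → ∑ P ∈ Z, c P * eval P.rep F = 0 := by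
  have key : ∀ s : Fin (n + 1) →₀ ℕ, coeff s (∑ P ∈ Z, c P • veroneseForm j P) =
      if s.degree = j then (s.multinomial : ℂ) * ∑ P ∈ Z, c P * eval P.rep (monomial s 1)
      else 0 := by
    intro s
    rw [coeff_sum]
    simp only [coeff_smul, veroneseForm, coeff_linearForm_pow, smul_eq_mul]
    split_ifs
    · rw [Finset.mul_sum]
      exact Finset.sum_congr rfl fun P _ => by ring
    · simp
  constructor
  · intro h F hF
    have h0 : ∀ s ∈ F.support, ∑ P ∈ Z, c P * eval P.rep (monomial s 1) = 0 := by
      intro s hs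
      have hd : s.degree = j := hF.degree_eq_sum_deg_support hs ▸ rfl
      have := key s
      rw [h, coeff_zero, if_pos hd] at this
      refine (mul_eq_zero.1 this.symm).resolve_left ?_
      exact Nat.cast_ne_zero.2 (Nat.multinomial_pos _ _).ne'
    have e : ∀ P : ProjSpace n, eval P.rep F =
        ∑ s ∈ F.support, coeff s F * eval P.rep (monomial s 1) := by
      intro P
      conv_lhs => rw [F.as_sum]
      rw [map_sum]
      exact Finset.sum_congr rfl fun s _ => by
        rw [eval_monomial, eval_monomial, one_mul]
    simp only [e, Finset.mul_sum]
    rw [Finset.sum_comm]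
    refine Finset.sum_eq_zero fun s hs => ?_
    rw [← mul_zero (coeff s F), ← h0 s hs, Finset.mul_sum]
    exact Finset.sum_congr rfl fun P _ => by ring
  · intro h
    ext s
    rw [key, coeff_zero]
    split_ifs with hs
    · rw [h _ (isHomogeneous_monomial 1 hs), mul_zero]
    · rfl

lemma independentConditions_of_finrank_veroneseSpan {j : ℕ} {Z : Finset (ProjSpace n)}
    (h : Module.finrank ℂ (veroneseSpan j Z) = Z.card) : IndependentConditions j Z := by
  have hli : LinearIndependent ℂ (fun P : Z => veroneseForm j (P : ProjSpace n)) := by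
    rw [linearIndependent_iff_card_eq_finrank_span, Fintype.card_coe, ← h, Set.finrank,
      veroneseSpan, Set.image_eq_range]
    rfl
  intro c hc P hP
  have h0 := sum_smul_veroneseForm_eq_zero_iff.2 hc
  rw [← Finset.sum_coe_sort] at h0
  exact Fintype.linearIndependent_iff.1 hli (fun P => c P) h0 ⟨P, hP⟩

/-- The supremum is attained: its set contains `0` and is bounded by `A.card`. -/
lemma finrank_veroneseSpan_of_card_le_kruskalRank {j : ℕ} {A A' : Finset (ProjSpace n)}
    (hA : A' ⊆ A) (h : A'.card ≤ kruskalRank j A) :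
    Module.finrank ℂ (veroneseSpan j A') = A'.card := by
  have hmem := Nat.sSup_mem (s := {k : ℕ | k ≤ A.card ∧ ∀ A' : Finset (ProjSpace n), A' ⊆ A →
      A'.card ≤ k → Module.finrank ℂ (veroneseSpan j A') = A'.card})
    ⟨0, Nat.zero_le _, fun A' _ h => by
      rw [Finset.card_eq_zero.1 (Nat.le_zero.1 h)]
      rw [veroneseSpan, Finset.coe_empty, Set.image_empty, Submodule.span_empty, finrank_bot]
      rfl⟩ ⟨A.card, fun k hk => hk.1⟩
  exact hmem.2 A' hA h

lemma computes_iff {d : ℕ} {A : Finset (ProjSpace n)} {T : MvPolynomial (Fin (n + 1)) ℂ} :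
    Computes d A T ↔ ∃ a : ProjSpace n → ℂ, ∑ P ∈ A, a P • veroneseForm d P = T := by
  rw [Computes, veroneseSpan, Submodule.mem_span_image_finset_iff_exists_fun']

/-- Two different sets computing the same form, the first one nonredundant and the second not
larger, yield a relation between a nonempty subset of the first and a disjoint set. -/
lemma exists_relation_of_computes {d : ℕ} {A B : Finset (ProjSpace n)}
    {T : MvPolynomial (Fin (n + 1)) ℂ} (hA : IsNonRedundant d A T) (hB : Computes d B T)
    (hcard : B.card ≤ A.card) (hne : B ≠ A) :
    ∃ (A' B' : Finset (ProjSpace n)) (c : ProjSpace n → ℂ), A' ⊆ A ∧ A' ≠ ∅ ∧ Disjoint A' B' ∧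
      B'.card ≤ A'.card ∧ (∀ P ∈ A', c P ≠ 0) ∧ (∀ P ∈ B', c P ≠ 0) ∧
      ∀ F : MvPolynomial (Fin (n + 1)) ℂ, F.IsHomogeneous d →
        ∑ P ∈ A', c P * eval P.rep F + ∑ P ∈ B', c P * eval P.rep F = 0 := by
  classical
  obtain ⟨a, ha⟩ := computes_iff.1 hA.1
  obtain ⟨b, hb⟩ := computes_iff.1 hB
  have ha0 : ∀ P ∈ A, a P ≠ 0 := by
    intro P hP h0
    refine hA.2 (A.erase P) (Finset.erase_ssubset hP) (computes_iff.2 ⟨a, ?_⟩)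
    rw [← ha, ← Finset.add_sum_erase _ _ hP, h0, zero_smul, zero_add]
  let c : ProjSpace n → ℂ := fun P => (if P ∈ A then a P else 0) - (if P ∈ B then b P else 0)
  have hrel : ∑ P ∈ A ∪ B, c P • veroneseForm d P = 0 := by
    simp only [c, sub_smul, Finset.sum_sub_distrib, ite_smul, zero_smul]
    rw [Finset.sum_ite_mem, Finset.sum_ite_mem, Finset.union_inter_cancel_left,
      Finset.union_inter_cancel_right, ha, hb, sub_self]
  rw [sum_smul_veroneseForm_eq_zero_iff] at hrel
  have hsub : A \ B ⊆ A.filter fun P => c P ≠ 0 := by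
    intro P hP
    rw [Finset.mem_sdiff] at hP
    rw [Finset.mem_filter]
    refine ⟨hP.1, ?_⟩
    simp only [c, if_pos hP.1, if_neg hP.2, sub_zero]
    exact ha0 P hP.1
  -- Common points whose coefficients do not cancel go to the `A` side. This keeps the sets disjoint
  -- and gives `|B'| ≤ |B \ A| ≤ |A \ B| ≤ |A'|`.
  refine ⟨A.filter fun P => c P ≠ 0, (B \ A).filter fun P => c P ≠ 0, c, Finset.filter_subset _ _,
    ?_, ?_, ?_, fun P hP => (Finset.mem_filter.1 hP).2, fun P hP => (Finset.mem_filter.1 hP).2, ?_⟩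
  · intro h0
    rw [h0, Finset.subset_empty, Finset.sdiff_eq_empty_iff_subset] at hsub
    exact hne (Finset.eq_of_subset_of_card_le hsub hcard).symm
  · exact Finset.disjoint_filter_filter Finset.disjoint_sdiff
  · have h1 := Finset.card_le_card hsub
    have h2 : ((B \ A).filter fun P => c P ≠ 0).card ≤ (B \ A).card := Finset.card_filter_le _ _
    have h3 := Finset.card_sdiff_add_card_inter A B
    have h4 := Finset.card_sdiff_add_card_inter B A
    rw [Finset.inter_comm] at h4
    omega
  · intro F hF
    refine Eq.trans ?_ (hrel F hF)
    rw [← Finset.union_sdiff_self_eq_union, Finset.sum_union Finset.disjoint_sdiff,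
      Finset.sum_filter, Finset.sum_filter]
    congr 1 <;>
    · refine Finset.sum_congr rfl fun P _ => ?_
      split_ifs with h
      · rfl
      · rw [not_not.1 h, zero_mul]

/-- A nonredundant set which is the only set of at most its cardinality computing `T` computes the
rank of `T`, and `T` is identifiable. -/
lemma rank_eq_and_isIdentifiable {d : ℕ} {A : Finset (ProjSpace n)}
    {T : MvPolynomial (Fin (n + 1)) ℂ} (hA : IsNonRedundant d A T)
    (h : ∀ B : Finset (ProjSpace n), Computes d B T → B.card ≤ A.card → B = A) :
    rank d T = A.card ∧ IsIdentifiable d T := by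
  have hle : rank d T ≤ A.card := Nat.sInf_le ⟨A, hA.1, rfl⟩
  obtain ⟨B, hB, hBcard⟩ := Nat.sInf_mem (s := {s : ℕ | ∃ A : Finset (ProjSpace n),
    Computes d A T ∧ A.card = s}) ⟨A.card, A, hA.1, rfl⟩
  change B.card = rank d T at hBcard
  have hr : rank d T = A.card := by
    rw [← hBcard, h B hB (by omega)]
  exact ⟨hr, A, ⟨hA, hr.symm⟩, fun B hB => h B hB.1.1 (by rw [hB.2, hr])⟩

/-- The Kruskal condition, inherited by subsets. -/
lemma independentConditions_or_vanishingForms_eq_bot {j : ℕ} {A A' : Finset (ProjSpace 2)}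
    (hA : A' ⊆ A) (hk : kruskalRank j A = min ((j + 2).choose 2) A.card) :
    IndependentConditions j A' ∨ vanishingForms j A' = ⊥ := by
  rcases le_total A'.card ((j + 2).choose 2) with h | h
  · left
    apply independentConditions_of_finrank_veroneseSpan
    apply finrank_veroneseSpan_of_card_le_kruskalRank hA
    rw [hk]
    exact le_min h (Finset.card_le_card hA)
  · right
    -- As many independent points as the dimension of the space of forms leave no nonzero form.
    obtain ⟨A'', hs, hcard⟩ := Finset.exists_subset_card_eq h
    have hind : IndependentConditions j A'' := by
      apply independentConditions_of_finrank_veroneseSpan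
      apply finrank_veroneseSpan_of_card_le_kruskalRank (hs.trans hA)
      rw [hk]
      exact le_min hcard.le (Finset.card_le_card (hs.trans hA))
    have h1 : A''.card + Module.finrank ℂ (vanishingForms j A'') = (j + 2).choose 2 :=
      hind.card_add_finrank.trans (finrank_ternary _)
    have h2 : vanishingForms j A'' = ⊥ := Submodule.finrank_eq_zero.1 (by omega)
    rw [eq_bot_iff, ← h2]
    exact fun F hF => ⟨hF.1, fun P hP => hF.2 P (hs hP)⟩

end Apolarity

end Waring

theorem theorem3p1 (d r : ℕ) (T : MvPolynomial (Fin 3) ℂ) (hT : T.IsHomogeneous d)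
    (A : Finset (Waring.ProjSpace 2)) (hr : A.card = r) (hA : Waring.IsNonRedundant d A T)
    (h : (∃ m : ℕ, d = 2 * m ∧
            Waring.kruskalRank (m - 1) A = min (Nat.choose (m + 1) 2) r ∧
            Waring.hilbertFunction A m = r ∧ r + 2 ≤ Nat.choose (m + 2) 2) ∨
         (∃ m : ℕ, d = 2 * m + 1 ∧
            Waring.kruskalRank m A = min (Nat.choose (m + 2) 2) r ∧
            Waring.hilbertFunction A (m + 1) = r ∧ r ≤ Nat.choose (m + 2) 2 + m / 2)) :
    Waring.rank d T = r ∧ Waring.IsIdentifiable d T := by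
  subst hr
  refine Waring.rank_eq_and_isIdentifiable hA fun B hB hcard => ?_
  by_contra hne
  obtain ⟨A', B', c, hsub, hA'0, hdisj, hcard', hcA, hcB, hc⟩ :=
    Waring.exists_relation_of_computes hA hB hcard hne
  have hle := Finset.card_le_card hsub
  apply hA'0
  rcases h with ⟨m, rfl, hk, hm, hbound⟩ | ⟨m, rfl, hk, hm, hbound⟩
  · rcases m with - | m
    -- For `m = 0` the subtraction `m - 1` truncates, but the bound reads `r + 2 ≤ 1`.
    · simp at hbound
    · exact Waring.eq_empty_of_relation_even
        (Waring.independentConditions_or_vanishingForms_eq_bot hsub hk)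
        ((Waring.independentConditions_iff_hilbertFunction.2 hm).mono hsub)
        (show A'.card + 2 ≤ (m + 1 + 2).choose 2 by omega) hcard' hdisj hcA hcB hc
  · exact Waring.eq_empty_of_relation_odd
      (Waring.independentConditions_or_vanishingForms_eq_bot hsub hk)
      ((Waring.independentConditions_iff_hilbertFunction.2 hm).mono hsub)
      (by omega) hcard' hdisj hcA hcB hc
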